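/- Let $1\le k<n$. Let $L\in\mathbb R^{n\times n}$ be symmetric with Moore–Penrose pseudo-inverse $L^\dagger$, let $V_{ion}\in\mathbb R^{n\times n}$ be diagonal, let $w_1,\dots,w_m\in\mathbb R^n$, and let $\epsilon_{xc}:\mathbb R^n\to\mathbb R^n$ be twice differentiable with Jacobian $\mu_{xc}(\rho)=\partial\epsilon_{xc}/\partial\rho$. Let $e=(1,\dots,1)^{\mathrm T}\in\mathbb R^n$. For $X=[x_1,\dots,x_k]\in\mathbb R^{n\times k}$ put $\rho(X)=\operatorname{diag}(XX^{\mathrm T})$ (the vector of diagonal entries), $$E(X)=\tfrac14\operatorname{tr}(X^{\mathrm T}LX)+\tfrac12\operatorname{tr}(X^{\mathrm T}V_{ion}X)+\tfrac12\sum_{i=1}^{k}\sum_{l=1}^{m}|x_i^{\mathrm T}w_l|^2+\tfrac14\rho(X)^{\mathrm T}L^\dagger\rho(X)+\tfrac12e^{\mathrm T}\epsilon_{xc}(\rho(X)),$$ $$H(X)=\tfrac12L+V_{ion}+\sum_{l=1}^{m}w_lw_l^{\mathrm T}+\operatorname{Diag}(L^\dagger\rho(X))+\operatorname{Diag}(\mu_{xc}(\rho(X))^{\mathrm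 T}e).$$ For $X_1,X_2\in\mathbb R^{n\times k}$ put $d_{c2}(X_1,X_2)=\min_{Q_1,Q_2}\|X_1Q_1-X_2Q_2\|_2$, the minimum over orthogonal $k\times k$ matrices $Q_1,Q_2$, where $\|\cdot\|_2$ is the spectral norm. Assume that there is a constant $\sigma$ such that for all $\rho,\tilde\rho\in\mathbb R^n$ $$\big\|\operatorname{Diag}(\mu_{xc}(\rho)^{\mathrm T}e)-\operatorname{Diag}(\mu_{xc}(\tilde\rho)^{\mathrm T}e)\big\|_{\mathrm F}\le\sigma\|\rho-\tilde\rho\|_2,\qquad \Big\|\sum_{i=1}^{n}\nabla^2(\epsilon_{xc})_i(\rho)\Big\|_2\le\sigma .$$ Let $X^0,X^1,\dots\in\mathbb R^{n\times k}$ be generated by the SCF iteration: $(X^0)^{\mathrm T}X^0=I$ and, for every $i\ge0$, $H(X^i)X^{i+1}=X^{i+1}\Lambda^{i+1}$ and $(X^{i+1})^{\mathrm T}X^{i+1}=I$, where $\Lambda^{i+1}$ is a diagonal matrix consisting of the $k$ smallest eigenvalues of $H(X^i)$ (with multiplicity). Assume that there is $\delta>0$ such that for every $i\ge 0$ the eigenvalues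 $\lambda_1\le\dots\le\lambda_n$ of $H(X^i)$ satisfy $\lambda_{k+1}-\lambda_k\ge\delta$. If $$\delta>12k\sqrt n\,(\|L^\dagger\|_2+\sigma),$$ then $\{X^i\}$ converges, as a sequence of subspaces, to a solution of the Kohn–Sham equation: there is $X^*\in\mathbb R^{n\times k}$ with $H(X^*)X^*=X^*\Lambda$ and $(X^*)^{\mathrm T}X^*=I$, where $\Lambda$ is a diagonal matrix consisting of the $k$ smallest eigenvalues of $H(X^*)$, such that $d_{c2}(X^i,X^*)\to0$ as $i\to\infty$. Moreover, for every $i\ge0$, $$E(X^i)-E(X^{i+1})\ \ge\ \Big(\frac{\delta}{4}-3k\sqrt n\,(\|L^\dagger\|_2+\sigma)\Big)\,d_{c2}(X^i,X^{i+1})^2 .$$ -/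

import Mathlib

open Filter Topology
open scoped Matrix

noncomputable section

namespace KohnSham

/-! ### Norms -/

open scoped Matrix.Norms.L2Operator in
/-- The spectral norm `‖A‖₂` of a real (possibly rectangular) matrix: its operator norm with
respect to the Euclidean norms. -/
def specNorm {p q : ℕ} (A : Matrix (Fin p) (Fin q) ℝ) : ℝ := ‖A‖

/-- The Frobenius norm of a real matrix. -/
def frobNorm {p q : ℕ} (A : Matrix (Fin p) (Fin q) ℝ) : ℝ :=
  Real.sqrt (∑ i, ∑ j, A i j ^ 2)

/-! ### Eigenvalues of symmetric matrices, spectral gap, pseudo-inverse -/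

/-- The eigenvalues of a real symmetric matrix, listed with multiplicity in nondecreasing order;
the index `j : Fin n` stands for the `(j + 1)`-st smallest eigenvalue. -/
def eigAsc {n : ℕ} {A : Matrix (Fin n) (Fin n) ℝ} (hA : A.IsHermitian) (j : Fin n) : ℝ :=
  hA.eigenvalues (Tuple.sort hA.eigenvalues j)

theorem eigAsc_monotone {n : ℕ} {A : Matrix (Fin n) (Fin n) ℝ} (hA : A.IsHermitian) :
    Monotone (eigAsc hA) :=
  Tuple.monotone_sort hA.eigenvalues

/-- The gap `λ_{k+1} - λ_k` between the `k`-th and the `(k+1)`-st smallest eigenvalues is at least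
the positive number `δ`. -/
def HasGap {n k : ℕ} (hk : 1 ≤ k) (hkn : k < n) {A : Matrix (Fin n) (Fin n) ℝ}
    (hA : A.IsHermitian) (δ : ℝ) : Prop :=
  0 < δ ∧ δ ≤ eigAsc hA ⟨k, hkn⟩ - eigAsc hA ⟨k - 1, by omega⟩

/-- `Y` has orthonormal columns and `A Y = Y Λ`, where `Λ` is a diagonal matrix consisting of the
`k` smallest eigenvalues of `A` (with multiplicity, in any order). -/
def IsLowestEigenvectors {n k : ℕ} (hkn : k < n) {A : Matrix (Fin n) (Fin n) ℝ}
    (hA : A.IsHermitian) (Y : Matrix (Fin n) (Fin k) ℝ) : Prop :=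
  Yᵀ * Y = 1 ∧ ∃ π : Equiv.Perm (Fin k),
    A * Y = Y * Matrix.diagonal (fun j => eigAsc hA (Fin.castLE hkn.le (π j)))

/-- The Moore-Penrose pseudo-inverse of a real symmetric matrix: if `A = U Diag(d) Uᵀ` is the
spectral decomposition, invert the nonzero entries of `d` and keep the zero ones (`0⁻¹ = 0`). -/
def pinv {n : ℕ} {A : Matrix (Fin n) (Fin n) ℝ} (hA : A.IsHermitian) :
    Matrix (Fin n) (Fin n) ℝ :=
  (hA.eigenvectorUnitary : Matrix (Fin n) (Fin n) ℝ) *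
    Matrix.diagonal (fun i => (hA.eigenvalues i)⁻¹) *
    (hA.eigenvectorUnitary : Matrix (Fin n) (Fin n) ℝ)ᵀ

theorem spectral_eq {n : ℕ} {A : Matrix (Fin n) (Fin n) ℝ} (hA : A.IsHermitian) :
    A = (hA.eigenvectorUnitary : Matrix (Fin n) (Fin n) ℝ) *
      Matrix.diagonal hA.eigenvalues *
      (hA.eigenvectorUnitary : Matrix (Fin n) (Fin n) ℝ)ᵀ := by
  conv_lhs => rw [hA.spectral_theorem]
  simp [Unitary.conjStarAlgAut_apply, Matrix.star_eq_conjTranspose]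

theorem eigU_mul {n : ℕ} {A : Matrix (Fin n) (Fin n) ℝ} (hA : A.IsHermitian) :
    (hA.eigenvectorUnitary : Matrix (Fin n) (Fin n) ℝ)ᵀ *
      (hA.eigenvectorUnitary : Matrix (Fin n) (Fin n) ℝ) = 1 := by
  have h := Unitary.coe_star_mul_self hA.eigenvectorUnitary
  simpa [Matrix.star_eq_conjTranspose] using h

theorem conj_mul_conj {n : ℕ} {U : Matrix (Fin n) (Fin n) ℝ} (hU : Uᵀ * U = 1)
    (a b : Fin n → ℝ) :
    (U * Matrix.diagonal a * Uᵀ) * (U * Matrix.diagonal b * Uᵀ) =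
      U * Matrix.diagonal (fun i => a i * b i) * Uᵀ := by
  calc (U * Matrix.diagonal a * Uᵀ) * (U * Matrix.diagonal b * Uᵀ)
      = U * Matrix.diagonal a * (Uᵀ * U) * Matrix.diagonal b * Uᵀ := by
        simp only [Matrix.mul_assoc]
    _ = _ := by rw [hU, Matrix.mul_one, Matrix.mul_assoc U, Matrix.diagonal_mul_diagonal]

/-- `pinv` satisfies the four Penrose equations, which determine the pseudo-inverse. -/
theorem pinv_penrose {n : ℕ} {A : Matrix (Fin n) (Fin n) ℝ} (hA : A.IsHermitian) :
    A * pinv hA * A = A ∧ pinv hA * A * pinv hA = pinv hA ∧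
      (A * pinv hA)ᵀ = A * pinv hA ∧ (pinv hA * A)ᵀ = pinv hA * A := by
  have hU := eigU_mul hA
  have hs := spectral_eq hA
  unfold pinv
  generalize (hA.eigenvectorUnitary : Matrix (Fin n) (Fin n) ℝ) = U at *
  generalize hA.eigenvalues = d at *
  subst hs
  have hinv : ∀ x : ℝ, x⁻¹ * x * x⁻¹ = x⁻¹ := fun x => by
    by_cases h : x = 0 <;> simp [h]
  have ht : ∀ a : Fin n → ℝ,
      (U * Matrix.diagonal a * Uᵀ)ᵀ = U * Matrix.diagonal a * Uᵀ := fun a => by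
    simp [Matrix.mul_assoc]
  refine ⟨?_, ?_, ?_, ?_⟩
  · rw [conj_mul_conj hU, conj_mul_conj hU]
    simp only [mul_inv_mul_cancel]
  · rw [conj_mul_conj hU, conj_mul_conj hU]
    simp only [hinv]
  · rw [conj_mul_conj hU, ht]
  · rw [conj_mul_conj hU, ht]

theorem pinv_isHermitian {n : ℕ} {A : Matrix (Fin n) (Fin n) ℝ} (hA : A.IsHermitian) :
    (pinv hA).IsHermitian := by
  simp [pinv, Matrix.IsHermitian, Matrix.conjTranspose_eq_transpose_of_trivial, Matrix.mul_assoc]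

/-! ### The chordal 2-norm distance between subspaces -/

/-- `d_c2(X₁, X₂) = min ‖X₁ Q₁ - X₂ Q₂‖₂` over orthogonal `k × k` matrices `Q₁, Q₂`. (The infimum
is a minimum because the orthogonal group is compact.) -/
def dc2 {n k : ℕ} (X₁ X₂ : Matrix (Fin n) (Fin k) ℝ) : ℝ :=
  ⨅ Q : Matrix.orthogonalGroup (Fin k) ℝ × Matrix.orthogonalGroup (Fin k) ℝ,
    specNorm (X₁ * (Q.1 : Matrix (Fin k) (Fin k) ℝ) - X₂ * (Q.2 : Matrix (Fin k) (Fin k) ℝ))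

/-! ### The discretized Kohn-Sham model -/

/-- The charge density `ρ(X) = diag(X Xᵀ)`. -/
def density {n k : ℕ} (X : Matrix (Fin n) (Fin k) ℝ) : EuclideanSpace ℝ (Fin n) :=
  WithLp.toLp 2 (X * Xᵀ).diag

/-- The data of a discretized Kohn-Sham total energy functional on `n` grid points with `m`
nonlocal reference projection functions. -/
structure Model (n m : ℕ) where
  /-- the discretized Laplacian, a symmetric matrix -/
  L : Matrix (Fin n) (Fin n) ℝ
  L_symm : L.IsHermitian
  /-- the diagonal of the local ionic pseudopotential `V_ion` -/
  vIon : Fin n → ℝ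
  /-- the discretized pseudopotential reference projection functions -/
  w : Fin m → Fin n → ℝ
  /-- the exchange correlation function `ε_xc`, as a function of the density -/
  exc : EuclideanSpace ℝ (Fin n) → EuclideanSpace ℝ (Fin n)

namespace Model

variable {n m k : ℕ} (S : Model n m)

/-- The pseudo-inverse `L†`. -/
def Ldag : Matrix (Fin n) (Fin n) ℝ := pinv S.L_symm

/-- The Jacobian `μ_xc(ρ) = ∂ε_xc/∂ρ`, with entries `∂(ε_xc)_i/∂ρ_j`. -/
def muXc (ρ : EuclideanSpace ℝ (Fin n)) : Matrix (Fin n) (Fin n) ℝ :=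
  Matrix.of fun i j => fderiv ℝ S.exc ρ (EuclideanSpace.single j 1) i

/-- The vector `μ_xc(ρ)ᵀ e`, where `e` is the vector of ones. -/
def muXcSum (ρ : EuclideanSpace ℝ (Fin n)) : Fin n → ℝ :=
  (S.muXc ρ)ᵀ *ᵥ (fun _ => 1)

/-- The matrix `(∂²ε_xc/∂ρ²) e`, with `(j, l)` entry `∑ i, ∂²(ε_xc)_i/∂ρ_l∂ρ_j`. -/
def hessXcSum (ρ : EuclideanSpace ℝ (Fin n)) : Matrix (Fin n) (Fin n) ℝ :=
  Matrix.of fun j l => ∑ i,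
    fderiv ℝ (fderiv ℝ S.exc) ρ (EuclideanSpace.single l 1) (EuclideanSpace.single j 1) i

/-- The total energy
`E(X) = ¼ tr(Xᵀ L X) + ½ tr(Xᵀ V_ion X) + ½ ∑ᵢ ∑ₗ |xᵢᵀ wₗ|² + ¼ ρᵀ L† ρ + ½ eᵀ ε_xc(ρ)`,
with `xᵢ` the columns of `X`. -/
def energy (X : Matrix (Fin n) (Fin k) ℝ) : ℝ :=
  (1 / 4) * (Xᵀ * S.L * X).trace + (1 / 2) * (Xᵀ * Matrix.diagonal S.vIon * X).trace
    + (1 / 2) * ∑ i, ∑ l, |(fun a => X a i) ⬝ᵥ S.w l| ^ 2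
    + (1 / 4) * ((density X).ofLp ⬝ᵥ (S.Ldag *ᵥ (density X).ofLp))
    + (1 / 2) * ∑ a, S.exc (density X) a

/-- The Hamiltonian
`H(X) = ½ L + V_ion + ∑ₗ wₗ wₗᵀ + Diag(L† ρ) + Diag(μ_xc(ρ)ᵀ e)`. -/
def hamiltonian (X : Matrix (Fin n) (Fin k) ℝ) : Matrix (Fin n) (Fin n) ℝ :=
  (1 / 2 : ℝ) • S.L + Matrix.diagonal S.vIon + ∑ l, Matrix.vecMulVec (S.w l) (S.w l)
    + Matrix.diagonal (S.Ldag *ᵥ (density X).ofLp) + Matrix.diagonal (S.muXcSum (density X))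

theorem hamiltonian_isHermitian (X : Matrix (Fin n) (Fin k) ℝ) :
    (S.hamiltonian X).IsHermitian := by
  have hL : S.Lᵀ = S.L := by
    simpa [Matrix.IsHermitian, Matrix.conjTranspose_eq_transpose_of_trivial] using S.L_symm
  simp [hamiltonian, Matrix.IsHermitian, Matrix.conjTranspose_eq_transpose_of_trivial,
    Matrix.transpose_sum, Matrix.transpose_vecMulVec, hL]

/-- The condition on the exchange correlation part, with constant `σ`: `ε_xc` is twice
differentiable, its Jacobian is Lipschitz and its second derivative is bounded in the sense below. -/
structure XcBounded (σ : ℝ) : Prop where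
  differentiable : Differentiable ℝ S.exc
  differentiable_fderiv : Differentiable ℝ (fderiv ℝ S.exc)
  lipschitz : ∀ ρ ρ' : EuclideanSpace ℝ (Fin n),
    frobNorm (Matrix.diagonal (S.muXcSum ρ) - Matrix.diagonal (S.muXcSum ρ')) ≤ σ * ‖ρ - ρ'‖
  hess_le : ∀ ρ : EuclideanSpace ℝ (Fin n), specNorm (S.hessXcSum ρ) ≤ σ

/-- `X` solves the Kohn-Sham equation: `H(X) X = X Λ` and `Xᵀ X = I`, with `Λ` a diagonal matrix
consisting of the `k` smallest eigenvalues of `H(X)`. -/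
def IsKSSolution (hkn : k < n) (X : Matrix (Fin n) (Fin k) ℝ) : Prop :=
  IsLowestEigenvectors hkn (S.hamiltonian_isHermitian X) X

/-- `X⁰, X¹, …` is generated by the self-consistent field iteration: `X⁰` has orthonormal columns
and the columns of `X^{i+1}` are orthonormal eigenvectors of `H(Xⁱ)` for its `k` smallest
eigenvalues. -/
def IsSCFSequence (hkn : k < n) (X : ℕ → Matrix (Fin n) (Fin k) ℝ) : Prop :=
  (X 0)ᵀ * X 0 = 1 ∧
    ∀ i, IsLowestEigenvectors hkn (S.hamiltonian_isHermitian (X i)) (X (i + 1))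

/-- The Hamiltonians `H(Xⁱ)` are uniformly well posed with constant `δ`. -/
def UniformlyWellPosed (hk : 1 ≤ k) (hkn : k < n) (X : ℕ → Matrix (Fin n) (Fin k) ℝ)
    (δ : ℝ) : Prop :=
  ∀ i, HasGap hk hkn (S.hamiltonian_isHermitian (X i)) δ

end Model

end KohnSham

end

/-! Everything depends on `X` only through the projection `P = X Xᵀ`, so convergence is proved for
projections in the Frobenius norm, which dominates `dc2` (`dc2_le_frobNorm`).

The engine is `IsLowestEigenvectors.trace_gap`: if `Y` spans the lowest eigenspace of `A` and the
gap is at least δ, replacing `Y` by `Z` raises `tr (A P)` by at least `δ/2` times the squared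
projection distance. Write `c = ‖L†‖₂ + σ`, a Lipschitz constant of the density-dependent potential.

Contraction (`frobNorm_step_le`): for consecutive iterates `X, Y, Z`, adding the gap inequalities
for `H(X)` and `H(Y)` leaves only the change of potential paired with the change of density, so
distances shrink by the factor `c/δ < 1`. The projections converge, and passing to the limit in the
gap inequality identifies the limit.

Energy (`energy_sub_energy_ge`): to first order the energy change is half the trace change under
`H(X)`; the second-order remainder costs at most `c/2` times the squared distance.

Since `k√n ≥ 1`, the stated constants follow from these sharper ones. -/

namespace KohnSham

/-! ### Frobenius and spectral norms -/

open scoped Matrix.Norms.L2Operator in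
theorem specNorm_nonneg {p q : ℕ} (A : Matrix (Fin p) (Fin q) ℝ) : 0 ≤ specNorm A :=
  norm_nonneg _

theorem frobNorm_nonneg {p q : ℕ} (A : Matrix (Fin p) (Fin q) ℝ) : 0 ≤ frobNorm A :=
  Real.sqrt_nonneg _

theorem frobNorm_sq {p q : ℕ} (A : Matrix (Fin p) (Fin q) ℝ) :
    frobNorm A ^ 2 = ∑ i, ∑ j, A i j ^ 2 :=
  Real.sq_sqrt (Finset.sum_nonneg fun _ _ => Finset.sum_nonneg fun _ _ => sq_nonneg _)

theorem frobNorm_sq_eq_trace {p q : ℕ} (A : Matrix (Fin p) (Fin q) ℝ) :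
    frobNorm A ^ 2 = (Aᵀ * A).trace := by
  rw [frobNorm_sq, Finset.sum_comm]
  simp [Matrix.trace, Matrix.mul_apply, sq]

theorem abs_entry_le_frobNorm {p q : ℕ} (A : Matrix (Fin p) (Fin q) ℝ) (i : Fin p) (j : Fin q) :
    |A i j| ≤ frobNorm A := by
  refine abs_le_of_sq_le_sq ?_ (frobNorm_nonneg A)
  rw [frobNorm_sq]
  refine le_trans ?_ (Finset.single_le_sum (f := fun i => ∑ j, A i j ^ 2)
    (fun _ _ => Finset.sum_nonneg fun _ _ => sq_nonneg _) (Finset.mem_univ i))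
  exact Finset.single_le_sum (f := fun j => A i j ^ 2) (fun _ _ => sq_nonneg _)
    (Finset.mem_univ j)

theorem frobNorm_neg {p q : ℕ} (A : Matrix (Fin p) (Fin q) ℝ) : frobNorm (-A) = frobNorm A := by
  simp [frobNorm]

theorem frobNorm_sub_comm {p q : ℕ} (A B : Matrix (Fin p) (Fin q) ℝ) :
    frobNorm (A - B) = frobNorm (B - A) := by
  rw [← frobNorm_neg, neg_sub]

theorem frobNorm_diagonal {n : ℕ} (v : EuclideanSpace ℝ (Fin n)) :
    frobNorm (Matrix.diagonal v.ofLp) = ‖v‖ := by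
  rw [EuclideanSpace.norm_eq, frobNorm]
  congr 1
  refine Finset.sum_congr rfl fun i _ => ?_
  rw [Finset.sum_eq_single i] <;> simp +contextual [eq_comm]

theorem norm_diag_le_frobNorm {n : ℕ} (A : Matrix (Fin n) (Fin n) ℝ) :
    ‖(WithLp.toLp 2 A.diag : EuclideanSpace ℝ (Fin n))‖ ≤ frobNorm A := by
  rw [EuclideanSpace.norm_eq, frobNorm]
  refine Real.sqrt_le_sqrt (Finset.sum_le_sum fun i _ => ?_)
  simpa using Finset.single_le_sum (f := fun j => A i j ^ 2) (fun _ _ => sq_nonneg _)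
    (Finset.mem_univ i)

open scoped Matrix.Norms.L2Operator in
theorem norm_mulVec_le {p q : ℕ} (A : Matrix (Fin p) (Fin q) ℝ) (x : EuclideanSpace ℝ (Fin q)) :
    ‖(WithLp.toLp 2 (A *ᵥ x.ofLp) : EuclideanSpace ℝ (Fin p))‖ ≤ specNorm A * ‖x‖ :=
  Matrix.l2_opNorm_mulVec A x

open scoped Matrix.Norms.L2Operator in
theorem specNorm_le_frobNorm {p q : ℕ} (A : Matrix (Fin p) (Fin q) ℝ) :
    specNorm A ≤ frobNorm A := by
  unfold specNorm
  rw [Matrix.l2_opNorm_def]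
  refine ContinuousLinearMap.opNorm_le_bound _ (frobNorm_nonneg A) fun x => ?_
  refine le_of_sq_le_sq ?_ (mul_nonneg (frobNorm_nonneg A) (norm_nonneg x))
  rw [mul_pow, frobNorm_sq, EuclideanSpace.real_norm_sq_eq, EuclideanSpace.real_norm_sq_eq,
    Finset.sum_mul]
  refine Finset.sum_le_sum fun i _ => ?_
  exact Finset.sum_mul_sq_le_sq_mul_sq Finset.univ (fun j => A i j) (fun j => x j)

/-! ### Singular value decomposition and the chordal distance -/

/-- Singular value decomposition of a real square matrix. -/
theorem exists_svd {k : ℕ} (M : Matrix (Fin k) (Fin k) ℝ) :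
    ∃ U V : Matrix (Fin k) (Fin k) ℝ, Uᵀ * U = 1 ∧ Vᵀ * V = 1 ∧
      ∃ s : Fin k → ℝ, (∀ i, 0 ≤ s i) ∧ Uᵀ * M * V = Matrix.diagonal s := by
  have hM : (Mᵀ * M).IsHermitian := by
    simp [Matrix.IsHermitian, Matrix.conjTranspose_eq_transpose_of_trivial]
  have hV := eigU_mul hM
  have hs := spectral_eq hM
  generalize (hM.eigenvectorUnitary : Matrix (Fin k) (Fin k) ℝ) = V at hV hs
  generalize hM.eigenvalues = d at hs
  -- The columns of `M V` are orthogonal: their norms are the singular values, their directions the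
  -- left singular vectors. Zero columns have no direction, so the normalized nonzero ones are
  -- extended to an orthonormal basis.
  have hN : (M * V)ᵀ * (M * V) = Matrix.diagonal d := by
    calc (M * V)ᵀ * (M * V) = Vᵀ * (Mᵀ * M) * V := by
          simp only [Matrix.transpose_mul, Matrix.mul_assoc]
      _ = (Vᵀ * V) * Matrix.diagonal d * (Vᵀ * V) := by rw [hs]; simp only [Matrix.mul_assoc]
      _ = _ := by rw [hV, Matrix.one_mul, Matrix.mul_one]
  let c : Fin k → EuclideanSpace ℝ (Fin k) := fun j => WithLp.toLp 2 fun a => (M * V) a j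
  have hc : ∀ i j, inner ℝ (c i) (c j) = Matrix.diagonal d i j := fun i j => by
    rw [← hN]
    simp [c, PiLp.inner_apply, Matrix.mul_apply, mul_comm]
  have hd : ∀ i, d i = ‖c i‖ ^ 2 := fun i => by
    rw [← real_inner_self_eq_norm_sq, hc, Matrix.diagonal_apply_eq]
  have hon : Orthonormal ℝ (({i | c i ≠ 0} : Set (Fin k)).domRestrict
      fun i => (‖c i‖⁻¹ : ℝ) • c i) := by
    refine ⟨fun i => ?_, fun i j hij => ?_⟩
    · have : ‖c i‖ ≠ 0 := norm_ne_zero_iff.mpr i.2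
      simp [Set.domRestrict, norm_smul, this]
    · have : (i : Fin k) ≠ j := fun h => hij (Subtype.ext h)
      simp [Set.domRestrict, inner_smul_left, inner_smul_right, hc, this]
  obtain ⟨b, hb⟩ := hon.exists_orthonormalBasis_extension_of_card_eq (by simp)
  have hcb : ∀ j, c j = ‖c j‖ • b j := fun j => by
    by_cases h : c j = 0
    · simp [h]
    · rw [hb j h, smul_smul, mul_inv_cancel₀ (norm_ne_zero_iff.mpr h), one_smul]
  refine ⟨Matrix.of fun a i => b i a, V, ?_, hV, fun i => ‖c i‖, fun i => norm_nonneg _, ?_⟩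
  · ext i j
    have := orthonormal_iff_ite.mp b.orthonormal i j
    rw [Matrix.one_apply, ← this]
    simp [PiLp.inner_apply, Matrix.mul_apply, mul_comm]
  · ext i j
    have h1 : ((Matrix.of fun a i => b i a)ᵀ * M * V) i j = inner ℝ (b i) (c j) := by
      rw [Matrix.mul_assoc, Matrix.mul_apply]
      simp [PiLp.inner_apply, c, mul_comm]
    rw [h1, hcb j, inner_smul_right, orthonormal_iff_ite.mp b.orthonormal i j,
      Matrix.diagonal_apply]
    split_ifs with h <;> simp [h]

theorem mul_transpose_eq_one {k : ℕ} {U : Matrix (Fin k) (Fin k) ℝ} (hU : Uᵀ * U = 1) :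
    U * Uᵀ = 1 :=
  mul_eq_one_comm.mp hU

theorem mem_orthogonalGroup {k : ℕ} {U : Matrix (Fin k) (Fin k) ℝ} (hU : Uᵀ * U = 1) :
    U ∈ Matrix.orthogonalGroup (Fin k) ℝ := by
  rw [Matrix.mem_orthogonalGroup_iff]
  simpa [Matrix.star_eq_conjTranspose] using mul_transpose_eq_one hU

/-- Expand the square; a rank-`k` orthogonal projection satisfies `tr P² = k`. -/
theorem frobNorm_proj_sub_sq {n k : ℕ} {X Y : Matrix (Fin n) (Fin k) ℝ} (hX : Xᵀ * X = 1)
    (hY : Yᵀ * Y = 1) :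
    frobNorm (X * Xᵀ - Y * Yᵀ) ^ 2 = 2 * k - 2 * (X * Xᵀ * (Y * Yᵀ)).trace := by
  have hP : ∀ Z : Matrix (Fin n) (Fin k) ℝ, Zᵀ * Z = 1 →
      (Z * Zᵀ * (Z * Zᵀ)).trace = (k : ℝ) := fun Z hZ => by
    rw [Matrix.mul_assoc, ← Matrix.mul_assoc Zᵀ, hZ, Matrix.one_mul, Matrix.trace_mul_comm, hZ]
    simp
  rw [frobNorm_sq_eq_trace]
  simp only [Matrix.transpose_sub, Matrix.transpose_mul, Matrix.transpose_transpose,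
    Matrix.sub_mul, Matrix.mul_sub, Matrix.trace_sub, hP X hX, hP Y hY]
  rw [Matrix.trace_mul_comm (Y * Yᵀ)]
  ring

theorem conj_proj_apply_nonneg {n k p : ℕ} (X : Matrix (Fin n) (Fin k) ℝ)
    (V : Matrix (Fin n) (Fin p) ℝ) (i : Fin p) : 0 ≤ (Vᵀ * (X * Xᵀ) * V) i i := by
  have h : Vᵀ * (X * Xᵀ) * V = (Xᵀ * V)ᵀ * (Xᵀ * V) := by
    simp only [Matrix.transpose_mul, Matrix.transpose_transpose, Matrix.mul_assoc]
  rw [h, Matrix.mul_apply]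
  exact Finset.sum_nonneg fun a _ => by rw [Matrix.transpose_apply]; exact mul_self_nonneg _

/-- With `P = X Xᵀ`, the matrix `1 - Vᵀ P V` is the Gram matrix of `(1 - P) V`, so its diagonal is
nonnegative. -/
theorem conj_proj_apply_le_one {n k p : ℕ} {X : Matrix (Fin n) (Fin k) ℝ} (hX : Xᵀ * X = 1)
    {V : Matrix (Fin n) (Fin p) ℝ} (hV : Vᵀ * V = 1) (i : Fin p) :
    (Vᵀ * (X * Xᵀ) * V) i i ≤ 1 := by
  have h : 1 - Vᵀ * (X * Xᵀ) * V = (V - X * Xᵀ * V)ᵀ * (V - X * Xᵀ * V) := by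
    have h2 : X * (Xᵀ * (X * (Xᵀ * V))) = X * (Xᵀ * V) := by
      rw [← Matrix.mul_assoc Xᵀ X, hX, Matrix.one_mul]
    rw [← hV]
    simp only [Matrix.transpose_sub, Matrix.transpose_mul, Matrix.transpose_transpose,
      Matrix.sub_mul, Matrix.mul_sub, Matrix.mul_assoc, h2]
    abel
  have h3 := congrFun (congrFun h i) i
  rw [Matrix.sub_apply, Matrix.one_apply_eq, Matrix.mul_apply (M := (V - X * Xᵀ * V)ᵀ)] at h3
  refine sub_nonneg.mp (h3 ▸ Finset.sum_nonneg fun a _ => ?_)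
  rw [Matrix.transpose_apply]
  exact mul_self_nonneg _

theorem dc2_nonneg {n k : ℕ} (X Y : Matrix (Fin n) (Fin k) ℝ) : 0 ≤ dc2 X Y :=
  Real.iInf_nonneg fun _ => specNorm_nonneg _

/-- The chordal distance is bounded by the Frobenius distance of the orthogonal projections. -/
theorem dc2_le_frobNorm {n k : ℕ} {X Y : Matrix (Fin n) (Fin k) ℝ} (hX : Xᵀ * X = 1)
    (hY : Yᵀ * Y = 1) : dc2 X Y ≤ frobNorm (X * Xᵀ - Y * Yᵀ) := by
  obtain ⟨U, V, hU, hV, s, hs0, hs⟩ := exists_svd (Xᵀ * Y)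
  -- The singular vectors of `Xᵀ Y` align the two frames; any single pair bounds the infimum.
  have hle : dc2 X Y ≤ specNorm (X * U - Y * V) :=
    ciInf_le (f := fun Q : Matrix.orthogonalGroup (Fin k) ℝ × Matrix.orthogonalGroup (Fin k) ℝ =>
        specNorm (X * (Q.1 : Matrix (Fin k) (Fin k) ℝ) - Y * (Q.2 : Matrix (Fin k) (Fin k) ℝ)))
      ⟨0, by rintro _ ⟨Q, rfl⟩; exact specNorm_nonneg _⟩
      (⟨U, mem_orthogonalGroup hU⟩, ⟨V, mem_orthogonalGroup hV⟩)
  refine (hle.trans (specNorm_le_frobNorm _)).trans ?_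
  refine le_of_sq_le_sq ?_ (frobNorm_nonneg _)
  have hsq : Matrix.diagonal (fun i => s i * s i) = Vᵀ * (Yᵀ * (X * Xᵀ) * Y) * V := by
    rw [← Matrix.diagonal_mul_diagonal]
    nth_rewrite 1 [← Matrix.diagonal_transpose]
    rw [← hs]
    calc (Uᵀ * (Xᵀ * Y) * V)ᵀ * (Uᵀ * (Xᵀ * Y) * V)
        = Vᵀ * (Yᵀ * X) * (U * Uᵀ) * ((Xᵀ * Y) * V) := by
          simp only [Matrix.transpose_mul, Matrix.transpose_transpose, Matrix.mul_assoc]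
      _ = _ := by
        rw [mul_transpose_eq_one hU, Matrix.mul_one]
        simp only [Matrix.mul_assoc]
  have hs1 : ∀ i, s i ≤ 1 := fun i => by
    have h1 : (Y * V)ᵀ * (Y * V) = 1 := by
      rw [Matrix.transpose_mul, Matrix.mul_assoc, ← Matrix.mul_assoc Yᵀ, hY, Matrix.one_mul, hV]
    have h2 : s i * s i = ((Y * V)ᵀ * (X * Xᵀ) * (Y * V)) i i := by
      rw [← Matrix.diagonal_apply_eq (fun i => s i * s i) i, hsq]
      simp only [Matrix.transpose_mul, Matrix.mul_assoc]
    nlinarith [hs0 i, conj_proj_apply_le_one hX h1 i]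
  have hcross : ((X * U)ᵀ * (Y * V)).trace = ∑ i, s i := by
    rw [← Matrix.trace_diagonal, ← hs, Matrix.transpose_mul]
    simp only [Matrix.mul_assoc]
  have hunit : ∀ Z : Matrix (Fin n) (Fin k) ℝ, ∀ W : Matrix (Fin k) (Fin k) ℝ, Zᵀ * Z = 1 →
      Wᵀ * W = 1 → ((Z * W)ᵀ * (Z * W)).trace = (k : ℝ) := fun Z W hZ hW => by
    rw [Matrix.transpose_mul, Matrix.mul_assoc, ← Matrix.mul_assoc Zᵀ, hZ, Matrix.one_mul, hW]
    simp
  have hleft : frobNorm (X * U - Y * V) ^ 2 = 2 * k - 2 * ∑ i, s i := by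
    rw [frobNorm_sq_eq_trace]
    simp only [Matrix.transpose_sub, Matrix.sub_mul, Matrix.mul_sub, Matrix.trace_sub,
      hunit X U hX hU, hunit Y V hY hV]
    rw [← Matrix.trace_transpose ((Y * V)ᵀ * (X * U)), Matrix.transpose_mul,
      Matrix.transpose_transpose, hcross]
    ring
  have hright : (X * Xᵀ * (Y * Yᵀ)).trace = ∑ i, s i * s i := by
    rw [← Matrix.trace_diagonal, hsq, Matrix.trace_mul_comm (Vᵀ * _), ← Matrix.mul_assoc V,
      mul_transpose_eq_one hV, Matrix.one_mul, Matrix.trace_mul_comm _ Y, ← Matrix.mul_assoc Y,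
      Matrix.trace_mul_comm]
  rw [hleft, frobNorm_proj_sub_sq hX hY, hright]
  -- The squared distances are `2k - 2∑s` for the aligned frames and `2k - 2∑s²` for the
  -- projections; `0 ≤ s ≤ 1` compares them.
  have : ∑ i, s i * s i ≤ ∑ i, s i :=
    Finset.sum_le_sum fun i _ => mul_le_of_le_one_left (hs0 i) (hs1 i)
  linarith

/-! ### The variational gap inequality -/

/-- Spectral decomposition with the eigenvalues in nondecreasing order. -/
theorem exists_sorted_eigenbasis {n : ℕ} {A : Matrix (Fin n) (Fin n) ℝ} (hA : A.IsHermitian) :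
    ∃ U : Matrix (Fin n) (Fin n) ℝ, Uᵀ * U = 1 ∧
      A = U * Matrix.diagonal (eigAsc hA) * Uᵀ := by
  have hU := eigU_mul hA
  have hs := spectral_eq hA
  set τ := Tuple.sort hA.eigenvalues with hτ
  have he : eigAsc hA = hA.eigenvalues ∘ τ := rfl
  rw [he]
  generalize (hA.eigenvectorUnitary : Matrix (Fin n) (Fin n) ℝ) = V at hU hs
  generalize hA.eigenvalues = d at *
  refine ⟨V.submatrix id τ, ?_, ?_⟩
  · rw [Matrix.transpose_submatrix, ← Matrix.submatrix_mul _ _ _ _ _ Function.bijective_id, hU,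
      Matrix.submatrix_one_equiv]
  · rw [← Matrix.submatrix_diagonal_equiv, Matrix.submatrix_mul_equiv, Matrix.transpose_submatrix,
      Matrix.submatrix_mul_equiv, ← hs, Matrix.submatrix_id_id]

/-- The columns of `U` with index below `k`. -/
def firstCols {n k : ℕ} (hkn : k < n) (U : Matrix (Fin n) (Fin n) ℝ) : Matrix (Fin n) (Fin k) ℝ :=
  U.submatrix id (Fin.castLE hkn.le)

theorem sum_castLE {n k : ℕ} (hkn : k < n) {g : Fin n → ℝ} (hg : ∀ j : Fin n, k ≤ j → g j = 0) :
    ∑ i : Fin k, g (Fin.castLE hkn.le i) = ∑ j, g j := by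
  refine Fintype.sum_of_injective _ (Fin.castLE_injective hkn.le) _ _ (fun j hj => hg j ?_)
    fun _ => rfl
  by_contra h
  exact hj ⟨⟨j, by omega⟩, rfl⟩

theorem firstCols_transpose_mul {n k : ℕ} (hkn : k < n) {U : Matrix (Fin n) (Fin n) ℝ}
    (hU : Uᵀ * U = 1) : (firstCols hkn U)ᵀ * firstCols hkn U = 1 := by
  rw [firstCols, Matrix.transpose_submatrix,
    ← Matrix.submatrix_mul _ _ _ _ _ Function.bijective_id, hU,
    Matrix.submatrix_one _ (Fin.castLE_injective hkn.le)]

theorem firstCols_mul_transpose {n k : ℕ} (hkn : k < n) (U : Matrix (Fin n) (Fin n) ℝ) :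
    firstCols hkn U * (firstCols hkn U)ᵀ =
      U * Matrix.diagonal (fun j : Fin n => if (j : ℕ) < k then (1 : ℝ) else 0) * Uᵀ := by
  ext a b
  rw [Matrix.mul_apply, Matrix.mul_apply]
  simp only [Matrix.mul_diagonal]
  rw [← sum_castLE hkn]
  · simp [firstCols]
  · intro j hj
    simp [hj.not_gt]

theorem trace_conj_diagonal_mul {n : ℕ} (U : Matrix (Fin n) (Fin n) ℝ) (d : Fin n → ℝ)
    (P : Matrix (Fin n) (Fin n) ℝ) :
    (U * Matrix.diagonal d * Uᵀ * P).trace = ∑ j, d j * (Uᵀ * P * U) j j := by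
  rw [Matrix.mul_assoc, Matrix.mul_assoc, Matrix.trace_mul_comm, Matrix.mul_assoc,
    Matrix.trace]
  simp [Matrix.diagonal_mul]

/-- In the eigenbasis, `q j = (Uᵀ Z Zᵀ U) j j` lies in `[0, 1]` and sums to `k`, as does the
indicator `χ` of the first `k` indices. Hence all eigenvalues may be shifted by the `k`-th one, `μ`.
Terms below `k` are then nonnegative, the others at least `δ q j`, and the mass of `q` beyond `k` is
half the squared distance. The sign of δ plays no role. -/
theorem trace_gap_of_sorted {n k : ℕ} (hkn : k < n) {U : Matrix (Fin n) (Fin n) ℝ}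
    (hU : Uᵀ * U = 1) {lam : Fin n → ℝ} (hlam : Monotone lam) {δ : ℝ}
    (hδ : δ ≤ lam ⟨k, hkn⟩ - lam ⟨k - 1, by omega⟩) {Z : Matrix (Fin n) (Fin k) ℝ}
    (hZ : Zᵀ * Z = 1) :
    δ / 2 * frobNorm (Z * Zᵀ - firstCols hkn U * (firstCols hkn U)ᵀ) ^ 2 ≤
      (U * Matrix.diagonal lam * Uᵀ * (Z * Zᵀ)).trace -
        (U * Matrix.diagonal lam * Uᵀ * (firstCols hkn U * (firstCols hkn U)ᵀ)).trace := by
  set χ : Fin n → ℝ := fun j => if (j : ℕ) < k then (1 : ℝ) else 0 with hχ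
  have hW := firstCols_transpose_mul hkn hU
  rw [frobNorm_proj_sub_sq hZ hW, Matrix.trace_mul_comm (Z * Zᵀ), firstCols_mul_transpose,
    conj_mul_conj hU, trace_conj_diagonal_mul, trace_conj_diagonal_mul]
  have hq0 := conj_proj_apply_nonneg Z U
  have hq1 := conj_proj_apply_le_one hZ hU
  have htr : ∀ d : Fin n → ℝ, (U * Matrix.diagonal d * Uᵀ).trace = ∑ j, d j := fun d => by
    rw [Matrix.trace_mul_comm, ← Matrix.mul_assoc, hU, Matrix.one_mul, Matrix.trace_diagonal]
  have hqs : ∑ j, (Uᵀ * (Z * Zᵀ) * U) j j = k := by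
    have : ∑ j, (Uᵀ * (Z * Zᵀ) * U) j j = (Uᵀ * (Z * Zᵀ) * U).trace := rfl
    rw [this, Matrix.trace_mul_comm, ← Matrix.mul_assoc, mul_transpose_eq_one hU, Matrix.one_mul,
      Matrix.trace_mul_comm, hZ]
    simp
  have hχs : ∑ j, χ j = k := by
    rw [← htr, ← firstCols_mul_transpose hkn, Matrix.trace_mul_comm, hW]
    simp
  rw [htr]
  generalize (Uᵀ * (Z * Zᵀ) * U) = q at *
  set μ := lam ⟨k - 1, by omega⟩
  have key : ∑ j, δ * (q j j - χ j * q j j) ≤ ∑ j, (lam j - μ) * (q j j - χ j) := by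
    refine Finset.sum_le_sum fun j _ => ?_
    by_cases hj : (j : ℕ) < k
    · have h1 : lam j ≤ μ := hlam (Fin.mk_le_mk.mpr (by omega : (j : ℕ) ≤ k - 1))
      simp only [hχ, hj, if_true]
      nlinarith [hq1 j]
    · have h1 : lam ⟨k, hkn⟩ ≤ lam j := hlam (Fin.mk_le_mk.mpr (by omega : k ≤ (j : ℕ)))
      simp only [hχ, hj, if_false]
      nlinarith [hq0 j]
  have e1 : ∑ j, (lam j - μ) * (q j j - χ j) =
      ∑ j, lam j * q j j - ∑ j, lam j * χ j - μ * (∑ j, q j j - ∑ j, χ j) := by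
    rw [mul_sub, Finset.mul_sum, Finset.mul_sum, ← Finset.sum_sub_distrib,
      ← Finset.sum_sub_distrib, ← Finset.sum_sub_distrib]
    exact Finset.sum_congr rfl fun j _ => by ring
  rw [e1, hqs, hχs, ← Finset.mul_sum, Finset.sum_sub_distrib, hqs] at key
  linarith

/-- The matrix of lowest eigenvectors minimizes the trace. -/
theorem exists_isLowestEigenvectors {n k : ℕ} (hkn : k < n)
    {A : Matrix (Fin n) (Fin n) ℝ} (hA : A.IsHermitian) :
    ∃ W : Matrix (Fin n) (Fin k) ℝ, IsLowestEigenvectors hkn hA W ∧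
      ∀ Z : Matrix (Fin n) (Fin k) ℝ, Zᵀ * Z = 1 →
        (A * (W * Wᵀ)).trace ≤ (A * (Z * Zᵀ)).trace := by
  obtain ⟨U, hU, hAU⟩ := exists_sorted_eigenbasis hA
  refine ⟨firstCols hkn U, ⟨firstCols_transpose_mul hkn hU, 1, ?_⟩, fun Z hZ => ?_⟩
  · have h : A * U = U * Matrix.diagonal (eigAsc hA) := by
      nth_rewrite 1 [hAU]
      rw [Matrix.mul_assoc, hU, Matrix.mul_one]
    ext a i
    have := congrFun (congrFun h a) (Fin.castLE hkn.le i)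
    rw [Matrix.mul_diagonal] at this ⊢
    exact this
  -- With `δ = 0` no strict gap is required, so this applies to a limit Hamiltonian.
  · have := trace_gap_of_sorted hkn hU (eigAsc_monotone hA) (δ := 0)
      (sub_nonneg.mpr (eigAsc_monotone hA (Fin.mk_le_mk.mpr (by omega)))) hZ
    rw [← hAU] at this
    linarith

/-- The gap separates the eigenvalues of `Y` from those of index at least `k`, so `Y` has no
component there. Thus `Y` is the first `k` eigenvectors times an orthogonal `D`, which cancels in `Y
Yᵀ`. -/
theorem IsLowestEigenvectors.mul_transpose_eq {n k : ℕ} {hk : 1 ≤ k} {hkn : k < n}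
    {A : Matrix (Fin n) (Fin n) ℝ} {hA : A.IsHermitian} {δ : ℝ} (hgap : HasGap hk hkn hA δ)
    {Y : Matrix (Fin n) (Fin k) ℝ} (hY : IsLowestEigenvectors hkn hA Y)
    {U : Matrix (Fin n) (Fin n) ℝ} (hU : Uᵀ * U = 1)
    (hAU : A = U * Matrix.diagonal (eigAsc hA) * Uᵀ) :
    Y * Yᵀ = firstCols hkn U * (firstCols hkn U)ᵀ := by
  obtain ⟨hY1, π, hπ⟩ := hY
  have hC : Matrix.diagonal (eigAsc hA) * (Uᵀ * Y) =
      Uᵀ * Y * Matrix.diagonal (fun j => eigAsc hA (Fin.castLE hkn.le (π j))) := by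
    rw [Matrix.mul_assoc Uᵀ, ← hπ]
    nth_rewrite 2 [hAU]
    rw [Matrix.mul_assoc, Matrix.mul_assoc, ← Matrix.mul_assoc Uᵀ U, hU, Matrix.one_mul]
  have hzero : ∀ (j : Fin n) (l : Fin k), k ≤ (j : ℕ) → (Uᵀ * Y) j l = 0 := fun j l hj => by
    have h := congrFun (congrFun hC j) l
    rw [Matrix.diagonal_mul, Matrix.mul_diagonal] at h
    have h1 : eigAsc hA ⟨k, hkn⟩ ≤ eigAsc hA j := eigAsc_monotone hA (Fin.mk_le_mk.mpr hj)
    have h2 : eigAsc hA (Fin.castLE hkn.le (π l)) ≤ eigAsc hA ⟨k - 1, by omega⟩ :=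
      eigAsc_monotone hA (Fin.mk_le_mk.mpr (by have := (π l).2; omega))
    have h3 := hgap.1
    have h4 := hgap.2
    have h5 : (eigAsc hA j - eigAsc hA (Fin.castLE hkn.le (π l))) * (Uᵀ * Y) j l = 0 := by
      linarith
    rcases mul_eq_zero.mp h5 with h6 | h6
    · linarith
    · exact h6
  set D : Matrix (Fin k) (Fin k) ℝ := (firstCols hkn U)ᵀ * Y with hD
  have hYD : Y = firstCols hkn U * D := by
    have h : Y = U * (Uᵀ * Y) := by
      rw [← Matrix.mul_assoc, mul_transpose_eq_one hU, Matrix.one_mul]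
    ext a l
    conv_lhs => rw [h]
    rw [Matrix.mul_apply, ← sum_castLE hkn, Matrix.mul_apply]
    · rfl
    · intro j hj
      rw [hzero j l hj, mul_zero]
  have hDD : Dᵀ * D = 1 := by
    rwa [hYD, Matrix.transpose_mul, Matrix.mul_assoc, ← Matrix.mul_assoc (firstCols hkn U)ᵀ,
      firstCols_transpose_mul hkn hU, Matrix.one_mul] at hY1
  rw [hYD, Matrix.transpose_mul, Matrix.mul_assoc, ← Matrix.mul_assoc D,
    mul_transpose_eq_one hDD, Matrix.one_mul]

theorem IsLowestEigenvectors.trace_gap {n k : ℕ} {hk : 1 ≤ k} {hkn : k < n}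
    {A : Matrix (Fin n) (Fin n) ℝ} {hA : A.IsHermitian} {δ : ℝ} (hgap : HasGap hk hkn hA δ)
    {Y : Matrix (Fin n) (Fin k) ℝ} (hY : IsLowestEigenvectors hkn hA Y)
    {Z : Matrix (Fin n) (Fin k) ℝ} (hZ : Zᵀ * Z = 1) :
    δ / 2 * frobNorm (Z * Zᵀ - Y * Yᵀ) ^ 2 ≤ (A * (Z * Zᵀ)).trace - (A * (Y * Yᵀ)).trace := by
  obtain ⟨U, hU, hAU⟩ := exists_sorted_eigenbasis hA
  rw [hY.mul_transpose_eq hgap hU hAU]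
  have := trace_gap_of_sorted hkn hU (eigAsc_monotone hA) hgap.2 hZ
  rwa [← hAU] at this

end KohnSham

namespace KohnSham

namespace Model

variable {n m k : ℕ} (S : Model n m)

/-! ### The effective potential as a function of the density -/

/-- The density-independent part of the Hamiltonian. -/
noncomputable def core : Matrix (Fin n) (Fin n) ℝ :=
  (1 / 2 : ℝ) • S.L + Matrix.diagonal S.vIon + ∑ l, Matrix.vecMulVec (S.w l) (S.w l)

/-- The diagonal of the density-dependent part of the Hamiltonian. -/
noncomputable def potential (ρ : EuclideanSpace ℝ (Fin n)) : EuclideanSpace ℝ (Fin n) :=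
  WithLp.toLp 2 (S.Ldag *ᵥ ρ.ofLp) + WithLp.toLp 2 (S.muXcSum ρ)

theorem hamiltonian_eq (X : Matrix (Fin n) (Fin k) ℝ) :
    S.hamiltonian X = S.core + Matrix.diagonal (S.potential (density X)).ofLp := by
  rw [hamiltonian, core, potential, add_assoc (_ + _), Matrix.diagonal_add]
  rfl

/-- The potential is arbitrary because the limit Hamiltonian is used before its density is known to
come from some `X`. -/
theorem core_add_diagonal_isHermitian (v : Fin n → ℝ) :
    (S.core + Matrix.diagonal v).IsHermitian := by
  have hL : S.Lᵀ = S.L := by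
    simpa [Matrix.IsHermitian, Matrix.conjTranspose_eq_transpose_of_trivial] using S.L_symm
  simp [core, Matrix.IsHermitian, Matrix.conjTranspose_eq_transpose_of_trivial,
    Matrix.transpose_sum, Matrix.transpose_vecMulVec, hL]

/-- A diagonal potential sees a projection only through its diagonal, the density. -/
theorem trace_core_add_diagonal_mul (v : Fin n → ℝ) (P : Matrix (Fin n) (Fin n) ℝ) :
    ((S.core + Matrix.diagonal v) * P).trace = (S.core * P).trace + v ⬝ᵥ P.diag := by
  rw [Matrix.add_mul, Matrix.trace_add]
  simp [Matrix.trace, Matrix.diagonal_mul, dotProduct]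

theorem density_sub_density_norm_le (X Y : Matrix (Fin n) (Fin k) ℝ) :
    ‖density X - density Y‖ ≤ frobNorm (X * Xᵀ - Y * Yᵀ) := by
  have h : density X - density Y = WithLp.toLp 2 (X * Xᵀ - Y * Yᵀ).diag := by
    simp [density, Matrix.diag_sub]
  rw [h]
  exact norm_diag_le_frobNorm _

theorem energy_eq (X : Matrix (Fin n) (Fin k) ℝ) :
    S.energy X = (1 / 2) * (S.core * (X * Xᵀ)).trace
      + (1 / 4) * ((density X).ofLp ⬝ᵥ (S.Ldag *ᵥ (density X).ofLp))
      + (1 / 2) * ∑ a, S.exc (density X) a := by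
  have h1 : ∀ A : Matrix (Fin n) (Fin n) ℝ, (Xᵀ * A * X).trace = (A * (X * Xᵀ)).trace := fun A => by
    rw [Matrix.mul_assoc, Matrix.trace_mul_comm, Matrix.mul_assoc]
  have h2 : ∑ i, ∑ l, |(fun a => X a i) ⬝ᵥ S.w l| ^ 2 =
      ((∑ l, Matrix.vecMulVec (S.w l) (S.w l)) * (X * Xᵀ)).trace := by
    rw [← h1, Matrix.mul_sum, Matrix.sum_mul, Matrix.trace_sum, Finset.sum_comm]
    refine Finset.sum_congr rfl fun l _ => Finset.sum_congr rfl fun i _ => ?_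
    rw [sq_abs, Matrix.mul_vecMulVec, Matrix.vecMulVec_mul, Matrix.diag_apply,
      Matrix.vecMulVec_apply, sq]
    simp [Matrix.mulVec, Matrix.vecMul, dotProduct, mul_comm]
  rw [energy, h1, h1, h2, core]
  simp only [Matrix.add_mul, Matrix.trace_add, Matrix.smul_mul, Matrix.trace_smul, smul_eq_mul]
  ring

variable {S} {σ : ℝ}

theorem XcBounded.nonneg (hxc : S.XcBounded σ) : 0 ≤ σ :=
  (specNorm_nonneg _).trans (hxc.hess_le 0)

theorem XcBounded.norm_muXcSum_sub_le (hxc : S.XcBounded σ) (ρ ρ' : EuclideanSpace ℝ (Fin n)) :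
    ‖(WithLp.toLp 2 (S.muXcSum ρ) - WithLp.toLp 2 (S.muXcSum ρ') : EuclideanSpace ℝ (Fin n))‖ ≤
      σ * ‖ρ - ρ'‖ := by
  rw [← frobNorm_diagonal]
  have := hxc.lipschitz ρ ρ'
  rwa [Matrix.diagonal_sub] at this

theorem XcBounded.norm_potential_sub_le (hxc : S.XcBounded σ) (ρ ρ' : EuclideanSpace ℝ (Fin n)) :
    ‖S.potential ρ - S.potential ρ'‖ ≤ (specNorm S.Ldag + σ) * ‖ρ - ρ'‖ := by
  have h : S.potential ρ - S.potential ρ' = WithLp.toLp 2 (S.Ldag *ᵥ (ρ - ρ').ofLp)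
      + (WithLp.toLp 2 (S.muXcSum ρ) - WithLp.toLp 2 (S.muXcSum ρ')) := by
    rw [potential, potential, WithLp.ofLp_sub, Matrix.mulVec_sub, WithLp.toLp_sub]
    abel
  rw [h, add_mul]
  exact (norm_add_le _ _).trans
    (add_le_add (norm_mulVec_le _ _) (hxc.norm_muXcSum_sub_le ρ ρ'))

/-- First-order expansion of the exchange correlation energy with a quadratic remainder. -/
theorem XcBounded.sum_exc_le (hxc : S.XcBounded σ) (ρ ρ' : EuclideanSpace ℝ (Fin n)) :
    ∑ a, S.exc ρ' a ≤ ∑ a, S.exc ρ a + S.muXcSum ρ ⬝ᵥ (ρ' - ρ).ofLp + σ * ‖ρ' - ρ‖ ^ 2 := by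
  let g' : EuclideanSpace ℝ (Fin n) → EuclideanSpace ℝ (Fin n) →L[ℝ] ℝ := fun ξ =>
    ∑ a, (EuclideanSpace.proj a : EuclideanSpace ℝ (Fin n) →L[ℝ] ℝ).comp (fderiv ℝ S.exc ξ)
  have hg : ∀ ξ, HasFDerivAt (fun ρ => ∑ a, S.exc ρ a) (g' ξ) ξ := fun ξ =>
    HasFDerivAt.fun_sum fun a _ =>
      (EuclideanSpace.proj a : EuclideanSpace ℝ (Fin n) →L[ℝ] ℝ).hasFDerivAt.comp ξ
        (hxc.differentiable ξ).hasFDerivAt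
  -- The gradient of `∑ a, ε_xc(ρ) a` is `μ_xc(ρ)ᵀ e`, so the Lipschitz hypothesis controls the
  -- remainder.
  have hg' : ∀ ξ, g' ξ = innerSL ℝ (WithLp.toLp 2 (S.muXcSum ξ)) := fun ξ => by
    ext v
    have hv : v = ∑ j, v j • EuclideanSpace.single j (1 : ℝ) := by
      simpa using ((EuclideanSpace.basisFun (Fin n) ℝ).sum_repr v).symm
    have h1 : g' ξ v = ∑ a, fderiv ℝ S.exc ξ v a := by simp [g']
    have h2 : ∀ a, fderiv ℝ S.exc ξ v a = ∑ j, v j * S.muXc ξ a j := fun a => by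
      conv_lhs => rw [hv]
      simp [muXc]
    rw [h1, Finset.sum_congr rfl fun a _ => h2 a, Finset.sum_comm, innerSL_apply_apply,
      PiLp.inner_apply]
    simp [muXcSum, Matrix.mulVec, dotProduct, Finset.mul_sum]
  have hb : ∀ ξ ∈ segment ℝ ρ ρ', ‖g' ξ - g' ρ‖ ≤ σ * ‖ρ' - ρ‖ := fun ξ hξ => by
    rw [hg', hg', ← map_sub, innerSL_apply_norm]
    refine (hxc.norm_muXcSum_sub_le ξ ρ).trans (mul_le_mul_of_nonneg_left ?_ hxc.nonneg)
    exact norm_sub_le_of_mem_segment hξ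
  have h := (convex_segment ρ ρ').norm_image_sub_le_of_norm_hasFDerivWithin_le'
    (fun ξ _ => (hg ξ).hasFDerivWithinAt) hb (left_mem_segment ℝ ρ ρ') (right_mem_segment ℝ ρ ρ')
  have h1 : g' ρ (ρ' - ρ) = S.muXcSum ρ ⬝ᵥ (ρ' - ρ).ofLp := by
    rw [hg']
    simp [PiLp.inner_apply, dotProduct, mul_comm]
  rw [h1] at h
  have := (le_abs_self _).trans h
  linarith

/-! ### Energy decrease and contraction for one SCF step -/

/-- One self-consistent field step decreases the energy. -/
theorem energy_sub_energy_ge {hk : 1 ≤ k} {hkn : k < n} (hxc : S.XcBounded σ)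
    {X Y : Matrix (Fin n) (Fin k) ℝ} {δ : ℝ} (hX : Xᵀ * X = 1)
    (hgap : HasGap hk hkn (S.hamiltonian_isHermitian X) δ)
    (hY : IsLowestEigenvectors hkn (S.hamiltonian_isHermitian X) Y) :
    (δ / 4 - (specNorm S.Ldag + σ) / 2) * frobNorm (X * Xᵀ - Y * Yᵀ) ^ 2 ≤
      S.energy X - S.energy Y := by
  have hgap' := hY.trace_gap hgap hX
  have hρ := density_sub_density_norm_le X Y
  have hexc := hxc.sum_exc_le (density X) (density Y)
  rw [S.hamiltonian_eq, trace_core_add_diagonal_mul, trace_core_add_diagonal_mul] at hgap'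
  rw [S.energy_eq, S.energy_eq]
  change _ ≤ _ + _ ⬝ᵥ (density X).ofLp - (_ + _ ⬝ᵥ (density Y).ofLp) at hgap'
  set ρ := density X
  set ρ' := density Y
  have hpot : ∀ v : Fin n → ℝ,
      (S.potential ρ).ofLp ⬝ᵥ v = v ⬝ᵥ (S.Ldag *ᵥ ρ.ofLp) + S.muXcSum ρ ⬝ᵥ v := fun v => by
    rw [potential, WithLp.ofLp_add, add_dotProduct]
    rw [dotProduct_comm v]
  have hsymm : ρ.ofLp ⬝ᵥ (S.Ldag *ᵥ ρ'.ofLp) = ρ'.ofLp ⬝ᵥ (S.Ldag *ᵥ ρ.ofLp) := by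
    have hL : S.Ldagᵀ = S.Ldag := by
      have := pinv_isHermitian S.L_symm
      rwa [Matrix.IsHermitian, Matrix.conjTranspose_eq_transpose_of_trivial] at this
    rw [Matrix.dotProduct_mulVec, ← Matrix.mulVec_transpose, hL, dotProduct_comm]
  have hquad : (ρ' - ρ).ofLp ⬝ᵥ (S.Ldag *ᵥ (ρ' - ρ).ofLp) ≤ specNorm S.Ldag * ‖ρ' - ρ‖ ^ 2 := by
    have h1 : (ρ' - ρ).ofLp ⬝ᵥ (S.Ldag *ᵥ (ρ' - ρ).ofLp) =
        inner ℝ (ρ' - ρ) (WithLp.toLp 2 (S.Ldag *ᵥ (ρ' - ρ).ofLp)) := by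
      simp [PiLp.inner_apply, dotProduct, mul_comm]
    rw [h1]
    refine (real_inner_le_norm _ _).trans ?_
    nlinarith [norm_mulVec_le S.Ldag (ρ' - ρ), norm_nonneg (ρ' - ρ)]
  rw [WithLp.ofLp_sub] at hquad hexc
  simp only [sub_dotProduct, dotProduct_sub, Matrix.mulVec_sub, hsymm] at hquad hexc
  rw [hpot, hpot] at hgap'
  rw [norm_sub_rev] at hρ
  have hρ2 : ‖ρ' - ρ‖ ^ 2 ≤ frobNorm (X * Xᵀ - Y * Yᵀ) ^ 2 :=
    pow_le_pow_left₀ (norm_nonneg _) hρ 2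
  have h3 := mul_le_mul_of_nonneg_left hρ2 (add_nonneg (specNorm_nonneg S.Ldag) hxc.nonneg)
  -- The quadratic term costs only `‖L†‖₂/4`; this lets it be weakened to `‖L†‖₂/2`, matching `σ/2`.
  have h4 := mul_nonneg (specNorm_nonneg S.Ldag) (sq_nonneg ‖ρ' - ρ‖)
  linarith

/-- Consecutive self-consistent field steps contract the distance of the projections. -/
theorem frobNorm_step_le {hk : 1 ≤ k} {hkn : k < n} (hxc : S.XcBounded σ)
    {X Y Z : Matrix (Fin n) (Fin k) ℝ} {δ : ℝ}
    (hgX : HasGap hk hkn (S.hamiltonian_isHermitian X) δ)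
    (hgY : HasGap hk hkn (S.hamiltonian_isHermitian Y) δ)
    (hY : IsLowestEigenvectors hkn (S.hamiltonian_isHermitian X) Y)
    (hZ : IsLowestEigenvectors hkn (S.hamiltonian_isHermitian Y) Z) :
    δ * frobNorm (Y * Yᵀ - Z * Zᵀ) ≤
      (specNorm S.Ldag + σ) * frobNorm (X * Xᵀ - Y * Yᵀ) := by
  have h1 := hY.trace_gap hgX hZ.1
  have h2 := hZ.trace_gap hgY hY.1
  rw [S.hamiltonian_eq, trace_core_add_diagonal_mul, trace_core_add_diagonal_mul] at h1 h2
  change _ ≤ _ + _ ⬝ᵥ (density _).ofLp - (_ + _ ⬝ᵥ (density _).ofLp) at h1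
  change _ ≤ _ + _ ⬝ᵥ (density _).ofLp - (_ + _ ⬝ᵥ (density _).ofLp) at h2
  rw [frobNorm_sub_comm] at h1
  have h3 : inner ℝ (S.potential (density X) - S.potential (density Y)) (density Z - density Y) =
      (S.potential (density X)).ofLp ⬝ᵥ (density Z).ofLp
      - (S.potential (density X)).ofLp ⬝ᵥ (density Y).ofLp
      - (S.potential (density Y)).ofLp ⬝ᵥ (density Z).ofLp
      + (S.potential (density Y)).ofLp ⬝ᵥ (density Y).ofLp := by
    simp only [inner_sub_left, inner_sub_right, PiLp.inner_apply, dotProduct]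
    simp only [RCLike.inner_apply, conj_trivial, mul_comm]
    ring
  have h4 := real_inner_le_norm (S.potential (density X) - S.potential (density Y))
    (density Z - density Y)
  have hc := add_nonneg (specNorm_nonneg S.Ldag) hxc.nonneg
  have h5 : ‖S.potential (density X) - S.potential (density Y)‖ * ‖density Z - density Y‖ ≤
      (specNorm S.Ldag + σ) * frobNorm (X * Xᵀ - Y * Yᵀ) * frobNorm (Y * Yᵀ - Z * Zᵀ) := by
    refine mul_le_mul ((hxc.norm_potential_sub_le _ _).trans ?_) ?_ (norm_nonneg _)
      (mul_nonneg hc (frobNorm_nonneg _))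
    · exact mul_le_mul_of_nonneg_left (density_sub_density_norm_le X Y) hc
    · rw [frobNorm_sub_comm]
      exact density_sub_density_norm_le Z Y
  -- The summed inequality carries an extra factor `‖Y Yᵀ - Z Zᵀ‖_F`, to be cancelled when positive.
  rcases (frobNorm_nonneg (Y * Yᵀ - Z * Zᵀ)).eq_or_lt with h0 | h0
  · rw [← h0, mul_zero]
    exact mul_nonneg hc (frobNorm_nonneg _)
  · refine le_of_mul_le_mul_right ?_ h0
    nlinarith

end Model

end KohnSham

/-! ### Convergence of the SCF iteration -/

namespace KohnSham

/-- Needed because the eigenvalues take the symmetry proof as an argument, which depends on the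
matrix. -/
theorem IsLowestEigenvectors.congr {n k : ℕ} {hkn : k < n} {A B : Matrix (Fin n) (Fin n) ℝ}
    {hA : A.IsHermitian} {hB : B.IsHermitian} (h : A = B) {Y : Matrix (Fin n) (Fin k) ℝ}
    (hY : IsLowestEigenvectors hkn hA Y) : IsLowestEigenvectors hkn hB Y := by
  subst h
  exact hY

/-- A sequence of matrices with geometrically decaying Frobenius increments converges. -/
theorem exists_tendsto_of_frobNorm_le_geometric {p q : ℕ} {P : ℕ → Matrix (Fin p) (Fin q) ℝ}
    {C r : ℝ} (hr : r < 1) (h : ∀ i, frobNorm (P i - P (i + 1)) ≤ C * r ^ i) :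
    ∃ Q, Tendsto P atTop (𝓝 Q) := by
  have hlim : ∀ a b, ∃ x, Tendsto (fun i => P i a b) atTop (𝓝 x) := fun a b =>
    cauchySeq_tendsto_of_complete (cauchySeq_of_le_geometric r C hr fun i => by
      rw [Real.dist_eq]
      exact (abs_entry_le_frobNorm (P i - P (i + 1)) a b).trans (h i))
  choose Q hQ using hlim
  exact ⟨Matrix.of Q, tendsto_pi_nhds.mpr fun a => tendsto_pi_nhds.mpr fun b => hQ a b⟩

theorem continuous_frobNorm {p q : ℕ} :
    Continuous (frobNorm : Matrix (Fin p) (Fin q) ℝ → ℝ) := by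
  unfold frobNorm
  fun_prop

theorem continuous_toLp_diag {n : ℕ} : Continuous fun P : Matrix (Fin n) (Fin n) ℝ =>
    (WithLp.toLp 2 P.diag : EuclideanSpace ℝ (Fin n)) :=
  (PiLp.continuous_toLp 2 _).comp continuous_id.matrix_diag

namespace Model

variable {n m k : ℕ} {S : Model n m} {σ : ℝ}

theorem XcBounded.continuous_potential (hxc : S.XcBounded σ) : Continuous S.potential := by
  have hc := add_nonneg (specNorm_nonneg S.Ldag) hxc.nonneg
  refine (LipschitzWith.of_dist_le_mul (K := ⟨specNorm S.Ldag + σ, hc⟩) fun ρ ρ' => ?_).continuous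
  rw [dist_eq_norm, dist_eq_norm]
  exact hxc.norm_potential_sub_le ρ ρ'

theorem IsSCFSequence.transpose_mul {hkn : k < n} {X : ℕ → Matrix (Fin n) (Fin k) ℝ}
    (hX : S.IsSCFSequence hkn X) (i : ℕ) : (X i)ᵀ * X i = 1 := by
  cases i with
  | zero => exact hX.1
  | succ i => exact (hX.2 i).1

theorem exists_isKSSolution_tendsto {hk : 1 ≤ k} {hkn : k < n} {δ : ℝ} (hxc : S.XcBounded σ)
    {X : ℕ → Matrix (Fin n) (Fin k) ℝ} (hX : S.IsSCFSequence hkn X)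
    (hgap : S.UniformlyWellPosed hk hkn X δ) (hδ : specNorm S.Ldag + σ < δ) :
    ∃ Xstar : Matrix (Fin n) (Fin k) ℝ, S.IsKSSolution hkn Xstar ∧
      Tendsto (fun i => dc2 (X i) Xstar) atTop (𝓝 0) := by
  have hδ0 : 0 < δ := (hgap 0).1
  have hc := add_nonneg (specNorm_nonneg S.Ldag) hxc.nonneg
  set c := specNorm S.Ldag + σ with hcdef
  have hgeo : ∀ i, frobNorm (X i * (X i)ᵀ - X (i + 1) * (X (i + 1))ᵀ) ≤
      frobNorm (X 0 * (X 0)ᵀ - X 1 * (X 1)ᵀ) * (c / δ) ^ i := fun i => by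
    induction i with
    | zero => simp
    | succ i ih =>
      have h := frobNorm_step_le hxc (hgap i) (hgap (i + 1)) (hX.2 i) (hX.2 (i + 1))
      rw [pow_succ, ← mul_assoc, ← mul_div_assoc, le_div_iff₀ hδ0, mul_comm _ δ, mul_comm _ c]
      exact h.trans (mul_le_mul_of_nonneg_left ih hc)
  obtain ⟨P, hP⟩ := exists_tendsto_of_frobNorm_le_geometric
    (P := fun i => X i * (X i)ᵀ) ((div_lt_one hδ0).mpr hδ) hgeo
  set ρ : EuclideanSpace ℝ (Fin n) := WithLp.toLp 2 P.diag with hρ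
  have hden : Tendsto (fun i => density (X i)) atTop (𝓝 ρ) :=
    (continuous_toLp_diag.tendsto P).comp hP
  have hH : Tendsto (fun i => S.hamiltonian (X i)) atTop
      (𝓝 (S.core + Matrix.diagonal (S.potential ρ).ofLp)) := by
    simp only [hamiltonian_eq]
    have hcont : Continuous fun ρ => S.core + Matrix.diagonal (S.potential ρ).ofLp :=
      continuous_const.add
        ((PiLp.continuous_ofLp 2 _).comp hxc.continuous_potential).matrix_diagonal
    exact (hcont.tendsto ρ).comp hden
  obtain ⟨W, hW, hmin⟩ :=
    exists_isLowestEigenvectors hkn (S.core_add_diagonal_isHermitian (S.potential ρ).ofLp)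
  have htr : Continuous fun AB : Matrix (Fin n) (Fin n) ℝ × Matrix (Fin n) (Fin n) ℝ =>
      (AB.1 * AB.2).trace :=
    (continuous_fst.matrix_mul continuous_snd).matrix_trace
  have hP1 : Tendsto (fun i => X (i + 1) * (X (i + 1))ᵀ) atTop (𝓝 P) :=
    hP.comp (tendsto_add_atTop_nat 1)
  have hfrob : ∀ {Y : ℕ → Matrix (Fin n) (Fin n) ℝ}, Tendsto Y atTop (𝓝 P) →
      Tendsto (fun i => frobNorm (Y i - W * Wᵀ)) atTop (𝓝 (frobNorm (P - W * Wᵀ))) :=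
    fun hY => (continuous_frobNorm.tendsto _).comp (hY.sub_const _)
  -- The gap inequality for `H(Xⁱ)` compares `X^{i+1}` with `W`. In the limit its right side is
  -- `tr(H W Wᵀ) - tr(H P)`, at most 0 by minimality of `W`. So `P = W Wᵀ`, without continuity of
  -- eigenvalues or a gap for the limit.
  have hle1 := le_of_tendsto_of_tendsto' (((hfrob hP1).pow 2).const_mul (δ / 2))
    (((htr.tendsto _).comp (hH.prodMk_nhds tendsto_const_nhds)).sub
      ((htr.tendsto _).comp (hH.prodMk_nhds hP1)))
    (fun i => by
      have := (hX.2 i).trace_gap (hgap i) hW.1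
      rwa [frobNorm_sub_comm] at this)
  have hle2 := ge_of_tendsto' ((htr.tendsto _).comp
    ((tendsto_const_nhds (x := S.core + Matrix.diagonal (S.potential ρ).ofLp)).prodMk_nhds hP))
    (fun i => hmin (X i) (hX.transpose_mul i))
  have hzero : frobNorm (P - W * Wᵀ) = 0 := by
    have : δ / 2 * frobNorm (P - W * Wᵀ) ^ 2 ≤ 0 := hle1.trans (sub_nonpos.mpr hle2)
    have h2 : frobNorm (P - W * Wᵀ) ^ 2 ≤ 0 := by
      by_contra! h
      exact absurd this (not_le.mpr (by positivity))
    exact pow_eq_zero_iff two_ne_zero |>.mp (le_antisymm h2 (sq_nonneg _))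
  have hPW : W * Wᵀ = P := by
    ext a b
    have := abs_entry_le_frobNorm (P - W * Wᵀ) a b
    rw [hzero, Matrix.sub_apply] at this
    exact (sub_eq_zero.mp (abs_nonpos_iff.mp this)).symm
  -- Since `W Wᵀ = P`, the limit Hamiltonian is `H(W)`: self-consistency.
  refine ⟨W, hW.congr ?_, ?_⟩
  · rw [hamiltonian_eq, density, hPW]
  · refine squeeze_zero (fun i => dc2_nonneg _ _)
      (fun i => dc2_le_frobNorm (hX.transpose_mul i) hW.1) ?_
    rw [← hzero]
    exact hfrob hP

end Model

end KohnSham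

theorem mainTheorem1 {n m k : ℕ} (hk : 1 ≤ k) (hkn : k < n) (S : KohnSham.Model n m)
    (σ δ : ℝ) (hxc : S.XcBounded σ)
    (X : ℕ → Matrix (Fin n) (Fin k) ℝ) (hX : S.IsSCFSequence hkn X)
    (hgap : S.UniformlyWellPosed hk hkn X δ)
    (hδ : 12 * (k : ℝ) * Real.sqrt n * (KohnSham.specNorm S.Ldag + σ) < δ) :
    (∃ Xstar : Matrix (Fin n) (Fin k) ℝ, S.IsKSSolution hkn Xstar ∧
      Tendsto (fun i => KohnSham.dc2 (X i) Xstar) atTop (𝓝 0)) ∧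
    ∀ i, (δ / 4 - 3 * (k : ℝ) * Real.sqrt n * (KohnSham.specNorm S.Ldag + σ)) *
        KohnSham.dc2 (X i) (X (i + 1)) ^ 2 ≤
      S.energy (X i) - S.energy (X (i + 1)) := by
  have hc := add_nonneg (KohnSham.specNorm_nonneg S.Ldag) hxc.nonneg
  have hkn1 : 1 ≤ (k : ℝ) * Real.sqrt n := by
    have h1 : (1 : ℝ) ≤ k := by exact_mod_cast hk
    have h2 : (1 : ℝ) ≤ Real.sqrt n := Real.one_le_sqrt.mpr (by exact_mod_cast (by omega : 1 ≤ n))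
    exact one_le_mul_of_one_le_of_one_le h1 h2
  have hmul := mul_le_mul_of_nonneg_right hkn1 hc
  refine ⟨KohnSham.Model.exists_isKSSolution_tendsto hxc hX hgap (by linarith), fun i => ?_⟩
  refine le_trans ?_ (KohnSham.Model.energy_sub_energy_ge hxc (hX.transpose_mul i) (hgap i)
    (hX.2 i))
  -- Replacing `dc2` by the larger projection distance needs `δ/4 - c/2 ≥ 0`, which follows from `δ
  -- > 12 c`.
  refine mul_le_mul (by linarith) (pow_le_pow_left₀ (KohnSham.dc2_nonneg _ _)
    (KohnSham.dc2_le_frobNorm (hX.transpose_mul i) (hX.transpose_mul (i + 1))) 2)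
    (sq_nonneg _) (by linarith)
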